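/- An \emph{interval} is a finite partially ordered set $P$ with a least element $\hat 0$ and a greatest element $\hat 1$. A \emph{hereditary family} $(\mathcal P,\sim,\cdot)$ is a nonempty family $\mathcal P$ of intervals, closed under forming subintervals $[x,y]$, with a product $\cdot:\mathcal P\times\mathcal P\to\mathcal P$ and an equivalence relation $\sim$ such that for all $P,Q,R\in\mathcal P$: (1) if $P\sim Q$ then $PR\sim QR$; (2) $(PQ)R\sim P(QR)$, $PQ\sim QP$, and $IP\sim PI\sim P$ for every single-element $I \in \mathcal P$; (3) if $P\sim Q$, there is a bijection $x\mapsto x'$ from $P$ to $Q$ with $[\hat 0_P,x]\sim[\hat 0_Q,x']$ and $[x,\hat 1_P]\sim[x',\hat 1_Q]$ for all $x\in P$; (4) there is a poset isomorphism $\psi:P\times Q\to PQ$ with $[\psi(\hat 0_P,\hat 0_Q),\psi(x,y)]\sim[\hat 0_P,x][\hat 0_Q,y]$ and $[\psi(x,y),\psi(\hat 1_P,\hat 1_Q)]\sim[x,\hat 1_P][y,\hat 1_Q]$ for all $(x,y)\in P\times Q$. Thus $\mathcal P/{\sim}$ is a commutative monoid; products below are taken in it, and the empty product is the class of the single-element intervals.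 $P\in\mathcal P$ is \emph{decomposable} if $P\sim QR$ for some non-singleton $Q,R\in\mathcal P$, and \emph{indecomposable} otherwise. Let $I(P)$ be the set of $x\in P\setminus\{\hat 0,\hat 1\}$ with $[\hat 0,x]$ indecomposable. The \emph{center} $Z(P)$ is the set of $a\in P$ such that $[\hat 0,a][\hat 0,a']\sim P$ for some $a'\in P$, and $Z'(P)$ is the set of minimal elements of $Z(P)\setminus\{\hat 0\}$. The family $\mathcal P$ is \emph{upper-indecomposable} if for every indecomposable $P\in\mathcal P$ and every $x<\hat 1$ in $P$ the interval $[x,\hat 1]$ is indecomposable. A \emph{forest} of $P$ is a pair $(F,J_F)$ with $F\subseteq I(P)$ and $J_F:2^F\to P\setminus\{\hat 1\}$ such that: (i) for $a_1,a_2\in F$, either $a_1\le a_2$, or $a_2\le a_1$, or $[\hat 0,a_1]\cap[\hat 0,a_2]=\{\hat 0\}$; (ii) if $G\subseteq F$ has the maximal elements $a_1,\dots,a_m$, then $[\hat 0,J_F(G)]\sim\prod_i[\hat 0,a_i]$; (iii) if $G'\subseteq G\subseteq F$, then $J_F(G')\le J_F(G)$; (iv) $J_F(\{a\})=a$ for all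 $a\in F$. For $b\in P$, a \emph{predecessor} of $b$ in $F$ is an $a\in F$ with $a<b$ and no $a'\in F$ with $a<a'<b$; let $\tilde b$ be the value of $J_F$ at the set of all predecessors of $b$ in $F$. Put $$\Theta(F,J_F)=\prod_{b\in F\cup Z'(P)}[\tilde b,b],\qquad d(F)=|F|+1 .$$ The forest expression $\sum_{(F,J_F)}(-1)^{d(F)}\,\Theta(F,J_F)$ for the antipode at $P$, summed over all forests of $P$, is called \emph{cancellation-free} if $(-1)^{d(F)}=(-1)^{d(F')}$ whenever $(F,J_F)$ and $(F',J_{F'})$ are forests of $P$ with $\Theta(F,J_F)\sim\Theta(F',J_{F'})$. (For indecomposable $P$, one has $\tilde b\le b$ for all $b \in F\cup Z'(P)$, so $\Theta$ is well defined.) \textbf{Theorem.} Let $\mathcal P$ be a hereditary family. The forest expression is cancellation-free for every indecomposable $P\in\mathcal P$ if and only if $\mathcal P$ is upper-indecomposable. -/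

import Mathlib

universe u

/-- A finite interval: a finite partially ordered set, on a subset `carrier` of the ambient type
`U`, with a least and a greatest element.  The order is a relation on `U` that only relates
elements of `carrier`, so that two intervals with the same elements and order are equal and
subintervals of subintervals are literally subintervals. -/
structure FinInterval (U : Type u) where
  carrier : Set U
  finite : carrier.Finite
  rel : U → U → Prop
  mem_of_rel : ∀ x y, rel x y → x ∈ carrier ∧ y ∈ carrier
  refl : ∀ x ∈ carrier, rel x x
  antisymm : ∀ x y, rel x y → rel y x → x = y
  trans : ∀ x y z, rel x y → rel y z → rel x z
  bot : U
  top : U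
  bot_mem : bot ∈ carrier
  top_mem : top ∈ carrier
  bot_rel : ∀ x ∈ carrier, rel bot x
  rel_top : ∀ x ∈ carrier, rel x top

namespace FinInterval

variable {U : Type u}

/-- The type of elements of `P`; it carries the order of `P` (and not an order of `U`). -/
def Elem (P : FinInterval U) : Type u := {x : U // x ∈ P.carrier}

instance : CoeSort (FinInterval U) (Type u) := ⟨Elem⟩

instance (P : FinInterval U) : PartialOrder P where
  le x y := P.rel x.1 y.1
  le_refl x := P.refl x.1 x.2
  le_trans x y z := P.trans x.1 y.1 z.1
  le_antisymm x y hxy hyx := Subtype.ext (P.antisymm x.1 y.1 hxy hyx)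

instance (P : FinInterval U) : BoundedOrder P where
  top := ⟨P.top, P.top_mem⟩
  le_top x := P.rel_top x.1 x.2
  bot := ⟨P.bot, P.bot_mem⟩
  bot_le x := P.bot_rel x.1 x.2

instance (P : FinInterval U) : Finite P := P.finite.to_subtype

noncomputable instance (P : FinInterval U) : Fintype P := Fintype.ofFinite P

/-- The subinterval `[x, y]` of `P`, with the induced order. -/
def Icc (P : FinInterval U) (x y : P) (h : x ≤ y) : FinInterval U where
  carrier := {z | P.rel x.1 z ∧ P.rel z y.1}
  finite := P.finite.subset fun z hz => (P.mem_of_rel x.1 z hz.1).2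
  rel a b := P.rel x.1 a ∧ P.rel a b ∧ P.rel b y.1
  mem_of_rel _ _ hab :=
    ⟨⟨hab.1, P.trans _ _ _ hab.2.1 hab.2.2⟩, ⟨P.trans _ _ _ hab.1 hab.2.1, hab.2.2⟩⟩
  refl a ha := ⟨ha.1, P.refl a (P.mem_of_rel _ _ ha.1).2, ha.2⟩
  antisymm a b hab hba := P.antisymm a b hab.2.1 hba.2.1
  trans _ _ _ hab hbc := ⟨hab.1, P.trans _ _ _ hab.2.1 hbc.2.1, hbc.2.2⟩
  bot := x.1
  top := y.1
  bot_mem := ⟨P.refl _ x.2, h⟩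
  top_mem := ⟨h, P.refl _ y.2⟩
  bot_rel _ ha := ⟨P.refl _ x.2, ha.1, ha.2⟩
  rel_top _ ha := ⟨ha.1, ha.2, P.refl _ y.2⟩

theorem Icc_bot_top (P : FinInterval U) : P.Icc ⊥ ⊤ bot_le = P := by
  obtain ⟨c, hfin, r, hmem, hrefl, hanti, htr, b, t, hb, ht, hbr, hrt⟩ := P
  have h1 : {z | r b z ∧ r z t} = c :=
    Set.ext fun z => ⟨fun hz => (hmem _ _ hz.1).2, fun hz => ⟨hbr z hz, hrt z hz⟩⟩
  have h2 : (fun z w => r b z ∧ r z w ∧ r w t) = r := by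
    funext z w
    exact propext ⟨fun hz => hz.2.1,
      fun hz => ⟨hbr z (hmem _ _ hz).1, hz, hrt w (hmem _ _ hz).2⟩⟩
  exact (FinInterval.mk.injEq ..).mpr ⟨h1, h2, rfl, rfl⟩

/-- A single-element interval. -/
def IsSingle (P : FinInterval U) : Prop := Nat.card P = 1

end FinInterval

/-- A (nonempty) family of finite intervals that is closed under forming subintervals. -/
structure IntervalFamily (U : Type u) where
  members : Set (FinInterval U)
  nonempty : members.Nonempty
  icc_mem : ∀ P ∈ members, ∀ (x y : P) (h : x ≤ y), P.Icc x y h ∈ members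

namespace IntervalFamily

variable {U : Type u}

/-- The members of the family, as a type. -/
abbrev Member (H : IntervalFamily U) : Type u := {P : FinInterval U // P ∈ H.members}

/-- The subinterval `[x, y]` of a member `P` as a member of the family. -/
def icc (H : IntervalFamily U) (P : H.Member) (x y : P.1) (h : x ≤ y) : H.Member :=
  ⟨P.1.Icc x y h, H.icc_mem P.1 P.2 x y h⟩

/-- The lower interval `[⊥, x]`. -/
def lower (H : IntervalFamily U) (P : H.Member) (x : P.1) : H.Member := H.icc P ⊥ x bot_le

/-- The upper interval `[x, ⊤]`. -/
def upper (H : IntervalFamily U) (P : H.Member) (x : P.1) : H.Member := H.icc P x ⊤ le_top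

end IntervalFamily

/-- A hereditary family `(H, ∼, ·)` of finite intervals; `eqv` is the equivalence relation `∼` and
`mul` is the product. -/
structure HereditaryFamily (U : Type u) extends IntervalFamily U where
  mul : toIntervalFamily.Member → toIntervalFamily.Member → toIntervalFamily.Member
  eqv : toIntervalFamily.Member → toIntervalFamily.Member → Prop
  eqv_equivalence : Equivalence eqv
  mul_congr : ∀ P Q R, eqv P Q → eqv (mul P R) (mul Q R)
  mul_assoc : ∀ P Q R, eqv (mul (mul P Q) R) (mul P (mul Q R))
  single_mul : ∀ I P, I.1.IsSingle → eqv (mul I P) (mul P I) ∧ eqv (mul P I) P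
  mul_comm : ∀ P Q, eqv (mul P Q) (mul Q P)
  exists_bijection : ∀ P Q, eqv P Q → ∃ e : P.1 ≃ Q.1, ∀ x : P.1,
    eqv (toIntervalFamily.lower P x) (toIntervalFamily.lower Q (e x)) ∧
    eqv (toIntervalFamily.upper P x) (toIntervalFamily.upper Q (e x))
  exists_orderIso : ∀ P Q, ∃ ψ : P.1 × Q.1 ≃o (mul P Q).1, ∀ (x : P.1) (y : Q.1),
    eqv (toIntervalFamily.icc (mul P Q) (ψ (⊥, ⊥)) (ψ (x, y)) (ψ.monotone ⟨bot_le, bot_le⟩))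
      (mul (toIntervalFamily.lower P x) (toIntervalFamily.lower Q y)) ∧
    eqv (toIntervalFamily.icc (mul P Q) (ψ (x, y)) (ψ (⊤, ⊤)) (ψ.monotone ⟨le_top, le_top⟩))
      (mul (toIntervalFamily.upper P x) (toIntervalFamily.upper Q y))

namespace HereditaryFamily

variable {U : Type u} (H : HereditaryFamily U)

/-- The equivalence relation `∼` as a setoid. -/
def setoid : Setoid H.Member := ⟨H.eqv, H.eqv_equivalence⟩

/-- The quotient `H / ∼`. -/
def Cls : Type u := Quotient H.setoid

/-- The class of a member in `H / ∼`. -/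
def cls (P : H.Member) : H.Cls := Quotient.mk H.setoid P

theorem cls_eq_iff (P Q : H.Member) : H.cls P = H.cls Q ↔ H.eqv P Q :=
  ⟨fun h => Quotient.exact h, fun h => Quotient.sound (s := H.setoid) h⟩

theorem isSingle_icc_self (P : H.Member) (x : P.1) : (H.icc P x x le_rfl).1.IsSingle := by
  unfold FinInterval.IsSingle
  rw [Nat.card_eq_one_iff_unique]
  refine ⟨⟨fun a b => Subtype.ext ?_⟩, ⟨⊥⟩⟩
  have key : ∀ c : (H.icc P x x le_rfl).1, c.1 = x.1 := fun c =>
    P.1.antisymm _ _ c.2.2 c.2.1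
  rw [key a, key b]

theorem exists_isSingle : ∃ I : H.Member, I.1.IsSingle :=
  ⟨H.icc ⟨H.nonempty.some, H.nonempty.some_mem⟩ ⊥ ⊥ le_rfl, H.isSingle_icc_self _ _⟩

theorem mul_congr₂ {P P' Q Q' : H.Member} (h : H.eqv P P') (h' : H.eqv Q Q') :
    H.eqv (H.mul P Q) (H.mul P' Q') :=
  H.eqv_equivalence.trans (H.mul_congr _ _ _ h) <|
    H.eqv_equivalence.trans (H.mul_comm _ _) <|
      H.eqv_equivalence.trans (H.mul_congr _ _ _ h') (H.mul_comm _ _)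

/-- The commutative monoid structure of `H / ∼` induced by the product; its identity is the class
of the single-element intervals. -/
noncomputable instance : CommMonoid H.Cls where
  mul := Quotient.map₂ (sa := H.setoid) (sb := H.setoid) (sc := H.setoid) H.mul
    (fun _ _ h _ _ h' => H.mul_congr₂ h h')
  one := H.cls H.exists_isSingle.choose
  mul_assoc a b c := by
    induction a using Quotient.inductionOn with | _ P
    induction b using Quotient.inductionOn with | _ Q
    induction c using Quotient.inductionOn with | _ R
    exact Quotient.sound (s := H.setoid) (H.mul_assoc P Q R)
  mul_comm a b := by
    induction a using Quotient.inductionOn with | _ P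
    induction b using Quotient.inductionOn with | _ Q
    exact Quotient.sound (s := H.setoid) (H.mul_comm P Q)
  one_mul a := by
    induction a using Quotient.inductionOn with | _ P
    have h := H.single_mul _ P H.exists_isSingle.choose_spec
    exact Quotient.sound (s := H.setoid) (H.eqv_equivalence.trans h.1 h.2)
  mul_one a := by
    induction a using Quotient.inductionOn with | _ P
    exact Quotient.sound (s := H.setoid) (H.single_mul _ P H.exists_isSingle.choose_spec).2

theorem cls_mul (P Q : H.Member) : H.cls (H.mul P Q) = H.cls P * H.cls Q := rfl

theorem cls_eq_one {P : H.Member} (h : P.1.IsSingle) : H.cls P = 1 := by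
  have h1 := H.single_mul P H.exists_isSingle.choose h
  have h2 := H.single_mul H.exists_isSingle.choose P H.exists_isSingle.choose_spec
  exact (H.cls_eq_iff _ _).2 (H.eqv_equivalence.trans (H.eqv_equivalence.symm h2.2)
    (H.eqv_equivalence.trans h1.1 h1.2))

variable {H}

/-- `P` is decomposable: it is, up to `∼`, a product of non-singleton members of `H`. -/
def Decomposable (P : H.Member) : Prop :=
  ∃ Q R : H.Member, ¬ Q.1.IsSingle ∧ ¬ R.1.IsSingle ∧ H.eqv P (H.mul Q R)

/-- `P` is indecomposable. -/
def Indecomposable (P : H.Member) : Prop := ¬ Decomposable P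

/-- The set `I(P)` of all `x ≠ ⊥, ⊤` such that `[⊥, x]` is indecomposable. -/
def indecSet (P : H.Member) : Set P.1 :=
  {x | x ≠ ⊥ ∧ x ≠ ⊤ ∧ Indecomposable (H.lower P x)}

/-- The center `Z(P)`. -/
def center (P : H.Member) : Set P.1 :=
  {a | ∃ a' : P.1, H.eqv (H.mul (H.lower P a) (H.lower P a')) (H.icc P ⊥ ⊤ bot_le)}

/-- The prime center `Z'(P)`: the minimal nonzero elements of the center. -/
def primeCenter (P : H.Member) : Set P.1 := {a | Minimal (fun z => z ∈ center P ∧ z ≠ ⊥) a}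

open Classical in
/-- A forest `(F, J_F)` of `P`.  The function `J` is defined on the subsets of `F`. -/
structure Forest (P : H.Member) where
  F : Finset P.1
  F_subset : ∀ a ∈ F, a ∈ indecSet P
  J : {G : Finset P.1 // G ⊆ F} → P.1
  J_ne_top : ∀ G, J G ≠ ⊤
  nonoverlapping : ∀ a ∈ F, ∀ b ∈ F,
    a ≤ b ∨ b ≤ a ∨ Set.Icc ⊥ a ∩ Set.Icc ⊥ b = {⊥}
  lower_J : ∀ G, H.cls (H.lower P (J G)) =
    ∏ a ∈ G.1.filter (fun a => Maximal (fun z => z ∈ G.1) a), H.cls (H.lower P a)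
  J_mono : ∀ G' G, G'.1 ⊆ G.1 → J G' ≤ J G
  J_singleton : ∀ a (ha : a ∈ F), J ⟨{a}, Finset.singleton_subset_iff.2 ha⟩ = a

namespace Forest

variable {P : H.Member} (T : Forest P)

open Classical in
/-- The set of predecessors of `b` in the forest. -/
noncomputable def predecessors (b : P.1) : {G : Finset P.1 // G ⊆ T.F} :=
  ⟨T.F.filter (fun a => a < b ∧ ¬ ∃ a' ∈ T.F, a < a' ∧ a' < b), Finset.filter_subset _ _⟩

/-- The element `b̃`, the value of `J` at the set of predecessors of `b`. -/
noncomputable def tilde (b : P.1) : P.1 := T.J (T.predecessors b)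

open Classical in
/-- `Θ(F, J_F)`, the product of the intervals `[b̃, b]` over `b ∈ F ∪ Z'(P)`, as an element of
`H / ∼`.  The condition `b̃ ≤ b` only serves to make `[b̃, b]` meaningful: it always holds when
`P` is indecomposable, see `tilde_le` below. -/
noncomputable def theta : H.Cls :=
  ∏ b ∈ T.F ∪ (primeCenter P).toFinset,
    if h : T.tilde b ≤ b then H.cls (H.icc P (T.tilde b) b h) else 1

/-- The exponent `d(F) = |F| + 1` of the sign of the term of the forest. -/
def d : ℕ := T.F.card + 1

end Forest

/-- The expression `∑ (-1) ^ d(F) Θ(F, J_F)` over all forests of `P` is cancellation-free: forests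
with equal terms `Θ` in `H / ∼` carry equal signs. -/
def CancellationFree (P : H.Member) : Prop :=
  ∀ T T' : Forest P, T.theta = T'.theta → (-1 : ℤ) ^ T.d = (-1 : ℤ) ^ T'.d

/-- The interval `[x, ⊤]` is indecomposable for all `x < ⊤` in `P`. -/
def UpperIndec (P : H.Member) : Prop := ∀ x : P.1, x < ⊤ → Indecomposable (H.upper P x)

variable (H) in
/-- Every indecomposable member of the family is upper-indecomposable. -/
def UpperIndecomposable : Prop := ∀ P : H.Member, Indecomposable P → UpperIndec P

theorem card_eq {P Q : H.Member} (h : H.eqv P Q) : Nat.card P.1 = Nat.card Q.1 := by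
  obtain ⟨e, -⟩ := H.exists_bijection P Q h
  exact Nat.card_congr e

/-- If `[⊥, x] ∼ [⊥, y]` and `x ≤ y`, then `x = y`. -/
theorem eq_of_le_of_lower {P : H.Member} {x y : P.1} (hxy : x ≤ y)
    (h : H.eqv (H.lower P x) (H.lower P y)) : x = y := by
  have hc : Set.ncard (H.lower P x).1.carrier = Set.ncard (H.lower P y).1.carrier := card_eq h
  have hs : (H.lower P x).1.carrier ⊆ (H.lower P y).1.carrier := fun z hz =>
    ⟨hz.1, P.1.trans _ _ _ hz.2 hxy⟩
  have he := Set.eq_of_subset_of_ncard_le hs hc.ge (H.lower P y).1.finite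
  have hy : y.1 ∈ (H.lower P y).1.carrier := (H.lower P y).1.top_mem
  rw [← he] at hy
  exact le_antisymm hxy hy.2

theorem isSingle_lower {P : H.Member} {x : P.1} (h : (H.lower P x).1.IsSingle) : x = ⊥ := by
  unfold FinInterval.IsSingle at h
  rw [Nat.card_eq_one_iff_unique] at h
  have := h.1.elim (⊤ : (H.lower P x).1) ⊥
  have hv : (⊤ : (H.lower P x).1).1 = (⊥ : (H.lower P x).1).1 := congrArg Subtype.val this
  exact Subtype.ext hv

/-- The prime center of an indecomposable interval contains at most the greatest element. -/
theorem eq_top_of_mem_primeCenter {P : H.Member} (hP : Indecomposable P) {a : P.1}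
    (ha : a ∈ primeCenter P) : a = ⊤ := by
  obtain ⟨⟨⟨a', haa'⟩, hne⟩, -⟩ := ha
  have hPP : H.icc P ⊥ ⊤ bot_le = P := Subtype.ext P.1.Icc_bot_top
  have ha'single : (H.lower P a').1.IsSingle := by
    by_contra h
    refine hP ⟨H.lower P a, H.lower P a', fun hs => hne (isSingle_lower hs), h, ?_⟩
    rw [hPP] at haa'
    exact H.eqv_equivalence.symm haa'
  have h1 := (H.single_mul _ (H.lower P a) ha'single).2
  have h2 := (H.single_mul _ (H.lower P a) ha'single).1
  have h3 : H.eqv (H.lower P a) (H.lower P ⊤) :=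
    H.eqv_equivalence.trans (H.eqv_equivalence.symm
      (H.eqv_equivalence.trans (H.mul_comm _ _) (H.eqv_equivalence.trans h2 h1))) haa'
  exact eq_of_le_of_lower le_top h3

/-- For indecomposable `P`, the intervals `[b̃, b]` occurring in `Θ` all make sense. -/
theorem Forest.tilde_le {P : H.Member} (hP : Indecomposable P) (T : Forest P) {b : P.1}
    (hb : b ∈ T.F ∨ b ∈ primeCenter P) : T.tilde b ≤ b := by
  classical
  rcases hb with hb | hb
  · let G : {G : Finset P.1 // G ⊆ T.F} := ⟨insert b (T.predecessors b).1,
      Finset.insert_subset hb (T.predecessors b).2⟩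
    have hle : ∀ z ∈ G.1, z ≤ b := by
      intro z hz
      rcases Finset.mem_insert.1 hz with rfl | hz
      · exact le_rfl
      · exact (Finset.mem_filter.1 hz).2.1.le
    have hbG : b ∈ G.1 := Finset.mem_insert_self _ _
    have hmax : G.1.filter (fun a => Maximal (fun z => z ∈ G.1) a) = {b} := by
      ext z
      rw [Finset.mem_filter, Finset.mem_singleton]
      constructor
      · rintro ⟨hz, hm⟩
        exact le_antisymm (hle z hz) (hm.2 hbG (hle z hz))
      · rintro rfl
        exact ⟨hbG, hbG, fun w hw _ => hle w hw⟩
    have hbJ : b ≤ T.J G := by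
      have h := T.J_mono ⟨{b}, Finset.singleton_subset_iff.2 hb⟩ G
        (Finset.singleton_subset_iff.2 hbG)
      rwa [T.J_singleton b hb] at h
    have hcls : H.cls (H.lower P (T.J G)) = H.cls (H.lower P b) := by
      have h := T.lower_J G
      convert h using 1
      have : ∏ a ∈ ({b} : Finset P.1), H.cls (H.lower P a) = H.cls (H.lower P b) :=
        Finset.prod_singleton _ _
      rw [← this]
      refine Finset.prod_congr ?_ fun _ _ => rfl
      rw [← hmax]
    have hJ := eq_of_le_of_lower hbJ ((H.cls_eq_iff _ _).1 hcls.symm)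
    exact (T.J_mono (T.predecessors b) G (Finset.subset_insert _ _)).trans hJ.ge
  · rw [eq_top_of_mem_primeCenter hP hb]
    exact le_top

end HereditaryFamily

/-! Sizes multiply in the monoid `H.Cls`, so `1` is its only unit, and the irreducible classes are
those of the indecomposable non-singletons. Factorization into irreducibles is unique
(`eq_of_prod_eq_prod`): an irreducible factor of largest size on either side also occurs on the
other side and can be cancelled.

For indecomposable `P`, `Θ(F, J_F)` has exactly `d(F) = |F| + 1` factors `[b̃, b]`, with `b` in `F`
or `b = ⊤`. Each is a nontrivial upper interval of the indecomposable `[⊥, b]`, hence irreducible if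
the family is upper-indecomposable. Unique factorization then recovers `d(F)` from `Θ`, so forests
with equal `Θ` have equal signs.

Conversely, let `x` be an atom of an indecomposable `P` with `[x, ⊤]` decomposable. Choose `y` with
`[x, y]` irreducible and `x < y < ⊤`. The forest `{x}` has `Θ = [⊥, x][x, y][y, ⊤]`. If `[⊥, y]` is
indecomposable, the chain `{x, y}` has the same `Θ`. Otherwise `[⊥, y] ∼ [⊥, x][x, y]`, and some
pair of non-overlapping `w, v ≤ y` realizes these two factors as `[⊥, v]` and `[⊥, w]`; with `J {w,
v} = y` it again has the same `Θ`. Either way the signs are opposite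
(`indecomposable_upper_of_isAtom`). Induction on the size of `P` passes from atoms to all `x < ⊤`.
-/

namespace HereditaryFamily

variable {U : Type*} {H : HereditaryFamily U}

/-! ### Nested subintervals and trivial classes -/

/-- An equality rather than an isomorphism is needed, because `∼` is not assumed to contain
isomorphism of posets. -/
theorem icc_icc (P : H.Member) (x y : P.1) (h : x ≤ y) (a b : (H.icc P x y h).1) (hab : a ≤ b) :
    H.icc (H.icc P x y h) a b hab =
      H.icc P ⟨a.1, (P.1.mem_of_rel _ _ a.2.1).2⟩ ⟨b.1, (P.1.mem_of_rel _ _ b.2.1).2⟩ hab.2.1 := by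
  apply Subtype.ext
  refine (FinInterval.mk.injEq ..).mpr ⟨?_, ?_, rfl, rfl⟩
  · ext z
    exact ⟨fun hz => ⟨hz.1.2.1, hz.2.2.1⟩, fun hz =>
      ⟨⟨a.2.1, hz.1, P.1.trans _ _ _ hz.2 b.2.2⟩, ⟨P.1.trans _ _ _ a.2.1 hz.1, hz.2, b.2.2⟩⟩⟩
  · funext z w
    refine propext ⟨fun hz => ⟨hz.1.2.1, hz.2.1.2.1, hz.2.2.2.1⟩, fun hz => ?_⟩
    have hxz := P.1.trans _ _ _ a.2.1 hz.1
    have hwy := P.1.trans _ _ _ hz.2.2 b.2.2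
    exact ⟨⟨a.2.1, hz.1, P.1.trans _ _ _ hz.2.1 hwy⟩, ⟨hxz, hz.2.1, hwy⟩,
      ⟨P.1.trans _ _ _ hxz hz.2.1, hz.2.2, b.2.2⟩⟩

/-- An element of `[x, y]` as an element of `P`. -/
def ofIcc {P : H.Member} {x y : P.1} {h : x ≤ y} (a : (H.icc P x y h).1) : P.1 :=
  ⟨a.1, (P.1.mem_of_rel _ _ a.2.1).2⟩

/-- An element of `P` between `x` and `y` as an element of `[x, y]`. -/
def toIcc {P : H.Member} {x y : P.1} (h : x ≤ y) (a : P.1) (hxa : x ≤ a) (hay : a ≤ y) :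
    (H.icc P x y h).1 := ⟨a.1, hxa, hay⟩

theorem le_ofIcc {P : H.Member} {x y : P.1} {h : x ≤ y} (a : (H.icc P x y h).1) :
    x ≤ ofIcc a := a.2.1

theorem ofIcc_le {P : H.Member} {x y : P.1} {h : x ≤ y} (a : (H.icc P x y h).1) :
    ofIcc a ≤ y := a.2.2

theorem lower_icc {P : H.Member} {x y : P.1} {h : x ≤ y} (a : (H.icc P x y h).1) :
    H.lower (H.icc P x y h) a = H.icc P x (ofIcc a) (le_ofIcc a) :=
  icc_icc P x y h ⊥ a bot_le

theorem upper_icc {P : H.Member} {x y : P.1} {h : x ≤ y} (a : (H.icc P x y h).1) :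
    H.upper (H.icc P x y h) a = H.icc P (ofIcc a) y (ofIcc_le a) :=
  icc_icc P x y h a ⊤ le_top

theorem lower_top (P : H.Member) : H.lower P ⊤ = P := Subtype.ext P.1.Icc_bot_top

theorem upper_bot (P : H.Member) : H.upper P ⊥ = P := Subtype.ext P.1.Icc_bot_top

theorem isSingle_of_cls_eq_one {P : H.Member} (h : H.cls P = 1) : P.1.IsSingle := by
  obtain ⟨I, hI⟩ := H.exists_isSingle
  rw [← H.cls_eq_one hI, cls_eq_iff] at h
  exact (card_eq h).trans hI

theorem cls_eq_one_iff {P : H.Member} : H.cls P = 1 ↔ P.1.IsSingle :=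
  ⟨isSingle_of_cls_eq_one, H.cls_eq_one⟩

theorem cls_surjective (c : H.Cls) : ∃ P, H.cls P = c := Quotient.exists_rep c

theorem cls_lower_eq_one {P : H.Member} {x : P.1} : H.cls (H.lower P x) = 1 ↔ x = ⊥ := by
  refine ⟨fun h => isSingle_lower (isSingle_of_cls_eq_one h), ?_⟩
  rintro rfl
  exact H.cls_eq_one (H.isSingle_icc_self P ⊥)

theorem cls_icc_eq_one {P : H.Member} {x y : P.1} {h : x ≤ y} :
    H.cls (H.icc P x y h) = 1 ↔ x = y := by
  constructor
  · intro hc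
    have hs := isSingle_of_cls_eq_one hc
    unfold FinInterval.IsSingle at hs
    rw [Nat.card_eq_one_iff_unique] at hs
    have := hs.1.elim (toIcc h x le_rfl h) (toIcc h y h le_rfl)
    exact congrArg ofIcc this
  · rintro rfl
    exact H.cls_eq_one (H.isSingle_icc_self P x)

theorem cls_upper_eq_one {P : H.Member} {x : P.1} : H.cls (H.upper P x) = 1 ↔ x = ⊤ :=
  cls_icc_eq_one

theorem eq_of_le_of_cls_lower {P : H.Member} {x y : P.1} (hxy : x ≤ y)
    (h : H.cls (H.lower P x) = H.cls (H.lower P y)) : x = y :=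
  eq_of_le_of_lower hxy ((H.cls_eq_iff _ _).1 h)

/-- Elements of a product, up to `∼`, correspond to pairs of elements of the factors. -/
theorem exists_equiv_prod {P A B : H.Member} (h : H.cls P = H.cls A * H.cls B) :
    ∃ e : P.1 ≃ A.1 × B.1, ∀ p,
      H.cls (H.lower P p) = H.cls (H.lower A (e p).1) * H.cls (H.lower B (e p).2) ∧
      H.cls (H.upper P p) = H.cls (H.upper A (e p).1) * H.cls (H.upper B (e p).2) := by
  rw [← cls_mul, cls_eq_iff] at h
  obtain ⟨e, he⟩ := H.exists_bijection _ _ h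
  obtain ⟨ψ, hψ⟩ := H.exists_orderIso A B
  -- Only the classes of lower and upper intervals are transported: the bijection coming from `∼`
  -- need not respect the order.
  refine ⟨e.trans ψ.symm.toEquiv, fun p => ?_⟩
  obtain ⟨q, hq⟩ := ψ.surjective (e p)
  have hs : (e.trans ψ.symm.toEquiv) p = q := by
    simp [← hq]
  rw [hs, ← cls_mul, ← cls_mul, (H.cls_eq_iff _ _).2 (he p).1, (H.cls_eq_iff _ _).2 (he p).2,
    cls_eq_iff, cls_eq_iff, ← hq]
  have hb : ψ (⊥, ⊥) = ⊥ := map_bot ψ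
  have ht : ψ (⊤, ⊤) = ⊤ := map_top ψ
  have h1 := hψ q.1 q.2
  simp only [hb, ht] at h1
  exact h1

/-! ### Sizes, units and irreducibles in the monoid of classes -/

/-- The number of elements of the members of a class. -/
noncomputable def Cls.card (c : H.Cls) : ℕ :=
  Quotient.lift (s := H.setoid) (fun P : H.Member => Nat.card P.1) (fun _ _ h => card_eq h) c

theorem card_cls (P : H.Member) : (H.cls P).card = Nat.card P.1 := rfl

theorem Cls.card_mul (a b : H.Cls) : (a * b).card = a.card * b.card := by
  obtain ⟨A, rfl⟩ := cls_surjective a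
  obtain ⟨B, rfl⟩ := cls_surjective b
  rw [← cls_mul, card_cls, card_cls, card_cls, ← Nat.card_prod]
  obtain ⟨ψ, -⟩ := H.exists_orderIso A B
  exact Nat.card_congr ψ.symm.toEquiv

theorem Cls.card_eq_one {a : H.Cls} : a.card = 1 ↔ a = 1 := by
  obtain ⟨A, rfl⟩ := cls_surjective a
  exact cls_eq_one_iff.symm

theorem Cls.card_pos (a : H.Cls) : 0 < a.card := by
  obtain ⟨A, rfl⟩ := cls_surjective a
  have : Nonempty A.1 := ⟨⊥⟩
  exact Nat.card_pos

theorem Cls.mul_eq_one {a b : H.Cls} : a * b = 1 ↔ a = 1 ∧ b = 1 := by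
  rw [← Cls.card_eq_one, ← Cls.card_eq_one, ← Cls.card_eq_one, Cls.card_mul, _root_.mul_eq_one]

theorem Cls.isUnit_iff {a : H.Cls} : IsUnit a ↔ a = 1 := by
  refine ⟨fun h => ?_, fun h => h ▸ isUnit_one⟩
  obtain ⟨b, hb⟩ := h.exists_right_inv
  exact (Cls.mul_eq_one.1 hb).1

theorem Cls.irreducible_iff {a : H.Cls} :
    Irreducible a ↔ a ≠ 1 ∧ ∀ b c, a = b * c → b = 1 ∨ c = 1 := by
  simp only [_root_.irreducible_iff, Cls.isUnit_iff, ne_eq]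

/-- Singletons are indecomposable by definition, so the class `1` has to be excluded separately. -/
theorem irreducible_cls {P : H.Member} :
    Irreducible (H.cls P) ↔ H.cls P ≠ 1 ∧ Indecomposable P := by
  rw [Cls.irreducible_iff]
  refine and_congr_right fun _ => ⟨?_, ?_⟩
  · rintro h ⟨Q, R, hQ, hR, hP⟩
    rw [← cls_eq_iff, cls_mul] at hP
    rcases h _ _ hP with h | h
    · exact hQ (cls_eq_one_iff.1 h)
    · exact hR (cls_eq_one_iff.1 h)
  · intro h b c hbc
    obtain ⟨B, rfl⟩ := cls_surjective b
    obtain ⟨C, rfl⟩ := cls_surjective c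
    by_contra! hne
    exact h ⟨B, C, fun hB => hne.1 (cls_eq_one_iff.2 hB), fun hC => hne.2 (cls_eq_one_iff.2 hC),
      (H.cls_eq_iff _ _).1 hbc⟩

/-! ### Unique factorization -/

theorem card_lower_le {P : H.Member} (x : P.1) : (H.cls (H.lower P x)).card ≤ (H.cls P).card :=
  Set.ncard_le_ncard (fun _ hz => (P.1.mem_of_rel _ _ hz.1).2) P.1.finite

theorem card_lower_lt {P : H.Member} {x : P.1} (h : x ≠ ⊤) :
    (H.cls (H.lower P x)).card < (H.cls P).card := by
  refine Set.ncard_lt_ncard ⟨fun _ hz => (P.1.mem_of_rel _ _ hz.1).2, fun hs => h ?_⟩ P.1.finite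
  exact top_le_iff.1 (hs P.1.top_mem).2

theorem card_upper_lt {P : H.Member} {x : P.1} (h : x ≠ ⊥) :
    (H.cls (H.upper P x)).card < (H.cls P).card := by
  refine Set.ncard_lt_ncard ⟨fun _ hz => (P.1.mem_of_rel _ _ hz.1).2, fun hs => h ?_⟩ P.1.finite
  exact le_bot_iff.1 (hs P.1.bot_mem).1

/-- An element with irreducible lower interval lies in a single factor of a factorization. -/
theorem exists_factor_of_irreducible_lower [DecidableEq H.Cls] (t : Multiset H.Cls) :
    ∀ (T : H.Member) (y : T.1), H.cls T = t.prod → Irreducible (H.cls (H.lower T y)) →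
      ∃ (B : H.Member) (z : B.1), H.cls B ∈ t ∧ H.cls (H.lower B z) = H.cls (H.lower T y) ∧
        H.cls (H.upper T y) = H.cls (H.upper B z) * (t.erase (H.cls B)).prod := by
  induction t using Multiset.induction with
  | empty =>
    intro T y hT hy
    have hs : (H.cls (H.lower T y)).card ≤ 1 := by
      have := card_lower_le y
      rwa [hT, Multiset.prod_zero, Cls.card_eq_one.2 rfl] at this
    exact absurd (Cls.card_eq_one.1 (le_antisymm hs (Cls.card_pos _))) (irreducible_cls.1 hy).1
  | cons b t ih =>
    intro T y hT hy
    obtain ⟨B, rfl⟩ := cls_surjective b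
    obtain ⟨T', hT'⟩ := cls_surjective t.prod
    rw [Multiset.prod_cons, ← hT'] at hT
    obtain ⟨e, he⟩ := exists_equiv_prod hT
    obtain ⟨hl, hu⟩ := he y
    -- The irreducible lower interval is a product over the two coordinates, so one coordinate of
    -- `y` is `⊥`, and that factor passes entirely into the upper interval.
    rcases (Cls.irreducible_iff.1 hy).2 _ _ hl with h1 | h1
    · rw [h1, one_mul] at hl
      rw [cls_lower_eq_one.1 h1, upper_bot] at hu
      obtain ⟨C, z, hC, hCl, hCu⟩ := ih T' (e y).2 hT' (hl ▸ hy)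
      refine ⟨C, z, Multiset.mem_cons_of_mem hC, hCl.trans hl.symm, ?_⟩
      rw [hu, hCu, Multiset.erase_cons_tail_of_mem hC, Multiset.prod_cons, mul_left_comm]
    · rw [h1, mul_one] at hl
      rw [cls_lower_eq_one.1 h1, upper_bot, hT'] at hu
      exact ⟨B, (e y).1, Multiset.mem_cons_self _ _, hl.symm, by rw [hu, Multiset.erase_cons_head]⟩

/-- Cancellation of an irreducible factor of maximal size. -/
theorem mem_and_prod_eq_of_irreducible [DecidableEq H.Cls] {c : H.Cls} {s t : Multiset H.Cls}
    (hc : Irreducible c) (hmax : ∀ b ∈ t, b.card ≤ c.card) (h : c * s.prod = t.prod) :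
    c ∈ t ∧ s.prod = (t.erase c).prod := by
  obtain ⟨C, rfl⟩ := cls_surjective c
  obtain ⟨S, hS⟩ := cls_surjective s.prod
  obtain ⟨T, hT⟩ := cls_surjective t.prod
  rw [← hS, ← hT] at h
  obtain ⟨e, he⟩ := exists_equiv_prod h.symm
  -- The pair `(⊤, ⊥)` has lower interval `c` and upper interval `s.prod`.
  obtain ⟨hl, hu⟩ := he (e.symm (⊤, ⊥))
  rw [e.apply_symm_apply, lower_top, cls_lower_eq_one.2 rfl, mul_one] at hl
  rw [e.apply_symm_apply, upper_bot, cls_upper_eq_one.2 rfl, one_mul] at hu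
  obtain ⟨B, z, hB, hBl, hBu⟩ :=
    exists_factor_of_irreducible_lower t T (e.symm (⊤, ⊥)) hT (by rwa [hl])
  rw [hl] at hBl
  -- `[⊥, z]` has the size of `c`, and `B` is no larger, so `[⊥, z]` is all of `B`.
  have hz : z = ⊤ := by
    by_contra hz
    have h1 := card_lower_lt hz
    rw [hBl] at h1
    exact absurd (hmax _ hB) (not_le.2 h1)
  subst hz
  rw [lower_top] at hBl
  rw [hu, cls_upper_eq_one.2 rfl, one_mul, hS, hBl] at hBu
  exact ⟨hBl ▸ hB, hBu⟩

/-- Factorization into irreducible classes is unique. -/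
theorem eq_of_prod_eq_prod (n : ℕ) : ∀ s t : Multiset H.Cls, s.card + t.card = n →
    (∀ c ∈ s, Irreducible c) → (∀ c ∈ t, Irreducible c) → s.prod = t.prod → s = t := by
  classical
  induction n using Nat.strong_induction_on with
  | _ n ih =>
    intro s t hn hs ht h
    rcases eq_or_ne (s + t) 0 with h0 | h0
    · rw [add_eq_zero] at h0
      rw [h0.1, h0.2]
    have step : ∀ (s t : Multiset H.Cls) (c : H.Cls), s.card + t.card = n →
        (∀ c ∈ s, Irreducible c) → (∀ c ∈ t, Irreducible c) → s.prod = t.prod → c ∈ s →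
        (∀ b ∈ t, b.card ≤ c.card) → s = t := by
      intro s t c hn hs ht h hcs hmax
      obtain ⟨s, rfl⟩ := Multiset.exists_cons_of_mem hcs
      rw [Multiset.prod_cons] at h
      obtain ⟨hct, he⟩ := mem_and_prod_eq_of_irreducible (hs c hcs) hmax h
      obtain ⟨t, rfl⟩ := Multiset.exists_cons_of_mem hct
      rw [Multiset.erase_cons_head] at he
      rw [Multiset.card_cons, Multiset.card_cons] at hn
      rw [ih (s.card + t.card) (by lia) s t rfl (fun b hb => hs b (Multiset.mem_cons_of_mem hb))
        (fun b hb => ht b (Multiset.mem_cons_of_mem hb)) he]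
    -- The maximum is over both sides: the cancelled factor must dominate the sizes on the side
    -- opposite to its own.
    obtain ⟨c, hc, hmax⟩ := (s + t).toFinset.exists_max_image Cls.card
      (by rwa [Multiset.toFinset_nonempty])
    simp only [Multiset.mem_toFinset, Multiset.mem_add] at hc hmax
    rcases hc with hc | hc
    · exact step s t c hn hs ht h hc fun b hb => hmax b (Or.inr hb)
    · exact (step t s c (by lia) ht hs h.symm hc fun b hb => hmax b (Or.inl hb)).symm

/-! ### The factors of `Θ` for indecomposable intervals -/

/-- `⊤` is central with partner `⊥`, so a minimal nonzero central element exists; by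
`eq_top_of_mem_primeCenter` it can only be `⊤`. -/
theorem top_mem_primeCenter {P : H.Member} (hP : Indecomposable P) (h : (⊥ : P.1) ≠ ⊤) :
    ⊤ ∈ primeCenter P := by
  have htop : (⊤ : P.1) ∈ {z | z ∈ center P ∧ z ≠ ⊥} := by
    refine ⟨⟨⊥, ?_⟩, h.symm⟩
    rw [← cls_eq_iff, cls_mul, cls_lower_eq_one.2 rfl, mul_one]
    rfl
  obtain ⟨m, -, hm⟩ := (Set.toFinite {z | z ∈ center P ∧ z ≠ ⊥}).exists_le_minimal htop
  have := eq_top_of_mem_primeCenter hP (a := m) hm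
  rw [this] at hm
  exact hm

namespace Forest

variable {P : H.Member} (T : Forest P)

theorem top_notMem : ⊤ ∉ T.F := fun h => (T.F_subset _ h).2.1 rfl

/-- Already the value of `J` at `∅` must differ from `⊤`, so singleton intervals have no forests. -/
theorem bot_ne_top (T : Forest P) : (⊥ : P.1) ≠ ⊤ := fun h =>
  T.J_ne_top ⟨∅, Finset.empty_subset _⟩ (le_antisymm le_top (h ▸ bot_le))

open Classical in
theorem F_union_primeCenter (hP : Indecomposable P) :
    T.F ∪ (primeCenter P).toFinset = insert ⊤ T.F := by
  ext a
  rw [Finset.mem_union, Set.mem_toFinset, Finset.mem_insert, or_comm]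
  refine or_congr_left ⟨eq_top_of_mem_primeCenter hP, ?_⟩
  rintro rfl
  exact top_mem_primeCenter hP T.bot_ne_top

open Classical in
/-- The factor `[b̃, b]` of `Θ`. -/
noncomputable def factor (b : P.1) : H.Cls :=
  if h : T.tilde b ≤ b then H.cls (H.icc P (T.tilde b) b h) else 1

open Classical in
theorem theta_eq (hP : Indecomposable P) :
    T.theta = T.factor ⊤ * ∏ b ∈ T.F, T.factor b := by
  rw [← Finset.prod_insert T.top_notMem, ← T.F_union_primeCenter hP]
  refine Finset.prod_congr ?_ fun _ _ => rfl
  congr!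

theorem factor_eq {b c : P.1} (hc : T.tilde b = c) (h : c ≤ b) :
    T.factor b = H.cls (H.icc P c b h) := by
  subst hc
  exact dif_pos h

theorem irreducible_lower {a : P.1} (ha : a ∈ T.F) : Irreducible (H.cls (H.lower P a)) :=
  irreducible_cls.2 ⟨fun h => (T.F_subset a ha).1 (cls_lower_eq_one.1 h), (T.F_subset a ha).2.2⟩

/-- If `b̃ = b`, the irreducible `[⊥, b]` would be a product of intervals `[⊥, a]` with `a < b`,
hence equivalent to one of them, against `eq_of_le_of_cls_lower`. -/
theorem tilde_ne {b : P.1} (hb : b ∈ T.F) : T.tilde b ≠ b := by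
  classical
  intro h
  have hl := T.lower_J (T.predecessors b)
  change H.cls (H.lower P (T.tilde b)) = _ at hl
  rw [h] at hl
  have hirr := T.irreducible_lower hb
  have hprod : ∀ s : Finset P.1, (∀ a ∈ s, a < b) →
      H.cls (H.lower P b) = ∏ a ∈ s, H.cls (H.lower P a) → False := by
    intro s
    induction s using Finset.induction_on with
    | empty => exact fun _ h => (irreducible_cls.1 hirr).1 h
    | insert a s ha ih =>
      intro hs h
      rw [Finset.prod_insert ha] at h
      rcases (Cls.irreducible_iff.1 hirr).2 _ _ h with h1 | h1
      · rw [h1, one_mul] at h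
        exact ih (fun c hc => hs c (Finset.mem_insert_of_mem hc)) h
      · rw [h1, mul_one] at h
        have hab := hs a (Finset.mem_insert_self _ _)
        exact hab.ne (eq_of_le_of_cls_lower hab.le h.symm)
  refine hprod _ (fun a ha => ?_) hl
  exact (Finset.mem_filter.1 (Finset.mem_filter.1 ha).1).2.1

end Forest

/-! ### Upper-indecomposable families are cancellation-free -/

theorem cancellationFree_of_upperIndecomposable (hH : H.UpperIndecomposable) {P : H.Member}
    (hP : Indecomposable P) : CancellationFree P := by
  classical
  have hirr : ∀ (T : Forest P) (b : P.1), b ∈ insert ⊤ T.F → Irreducible (T.factor b) := by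
    intro T b hb
    rw [Finset.mem_insert] at hb
    have hle : T.tilde b ≤ b := T.tilde_le hP <| hb.symm.imp_right fun h => by
      rw [h]
      exact top_mem_primeCenter hP T.bot_ne_top
    have hne : T.tilde b ≠ b := by
      rcases hb with rfl | hb
      · exact T.J_ne_top _
      · exact T.tilde_ne hb
    have hindec : Indecomposable (H.lower P b) := by
      rcases hb with rfl | hb
      · rwa [lower_top]
      · exact (T.F_subset b hb).2.2
    rw [T.factor_eq rfl hle, irreducible_cls]
    refine ⟨fun h => hne (cls_icc_eq_one.1 h), ?_⟩
    -- `[b̃, b]` is the upper interval at `b̃` of the indecomposable `[⊥, b]`.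
    have h := hH _ hindec (toIcc bot_le (T.tilde b) bot_le hle)
      (lt_of_le_of_ne le_top fun h => hne (congrArg ofIcc h))
    exact upper_icc (toIcc bot_le (T.tilde b) bot_le hle) ▸ h
  intro T T' h
  rw [T.theta_eq hP, T'.theta_eq hP, ← Finset.prod_insert T.top_notMem,
    ← Finset.prod_insert T'.top_notMem] at h
  have key := eq_of_prod_eq_prod _ ((insert ⊤ T.F).val.map T.factor)
    ((insert ⊤ T'.F).val.map T'.factor) rfl
    (fun c hc => by obtain ⟨b, hb, rfl⟩ := Multiset.mem_map.1 hc; exact hirr T b hb)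
    (fun c hc => by obtain ⟨b, hb, rfl⟩ := Multiset.mem_map.1 hc; exact hirr T' b hb) h
  have hcard := congrArg Multiset.card key
  rw [Multiset.card_map, Multiset.card_map, Finset.card_val, Finset.card_val,
    Finset.card_insert_of_notMem T.top_notMem, Finset.card_insert_of_notMem T'.top_notMem] at hcard
  rw [Forest.d, Forest.d, hcard]

/-! ### Realizing factorizations by elements; atoms and counting -/

/-- An element of `[⊥, y]` as an element of `P`. -/
def ofLower {P : H.Member} {y : P.1} (a : (H.lower P y).1) : P.1 := ofIcc (h := bot_le) a

theorem ofLower_le {P : H.Member} {y : P.1} (a : (H.lower P y).1) : ofLower a ≤ y := ofIcc_le a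

theorem lower_lower {P : H.Member} {y : P.1} (a : (H.lower P y).1) :
    H.lower (H.lower P y) a = H.lower P (ofLower a) := lower_icc a

/-- An element of `P` below `y` as an element of `[⊥, y]`. -/
def toLower {P : H.Member} {y : P.1} (a : P.1) (h : a ≤ y) : (H.lower P y).1 :=
  toIcc bot_le a bot_le h

theorem lower_toLower {P : H.Member} {a y : P.1} (h : a ≤ y) :
    H.lower (H.lower P y) (toLower a h) = H.lower P a := lower_lower (toLower a h)

theorem upper_toLower {P : H.Member} {a y : P.1} (h : a ≤ y) :
    H.upper (H.lower P y) (toLower a h) = H.icc P a y h := upper_icc (toIcc bot_le a bot_le h)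

/-- An element of `P` above `x` as an element of `[x, ⊤]`. -/
def toUpper {P : H.Member} {x : P.1} (a : P.1) (h : x ≤ a) : (H.upper P x).1 :=
  toIcc le_top a h le_top

theorem upper_toUpper {P : H.Member} {x a : P.1} (h : x ≤ a) :
    H.upper (H.upper P x) (toUpper a h) = H.upper P a := upper_icc (toIcc le_top a h le_top)

theorem exists_irreducible_mul (n : ℕ) : ∀ c : H.Cls, c.card = n → c ≠ 1 →
    ∃ q r : H.Cls, Irreducible q ∧ c = q * r := by
  induction n using Nat.strong_induction_on with
  | _ n ih =>
    intro c hn hc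
    by_cases hirr : Irreducible c
    · exact ⟨c, 1, hirr, (mul_one c).symm⟩
    rw [Cls.irreducible_iff] at hirr
    push Not at hirr
    obtain ⟨a, b, rfl, ha, hb⟩ := hirr hc
    have hb2 : 1 < b.card := lt_of_le_of_ne b.card_pos fun h => hb (Cls.card_eq_one.1 h.symm)
    obtain ⟨q, r, hq, rfl⟩ := ih a.card
      (by rw [← hn, Cls.card_mul]; exact lt_mul_of_one_lt_right a.card_pos hb2) a rfl ha
    exact ⟨q, r * b, hq, _root_.mul_assoc q r b⟩

/-- `q` is split off from one of the two nontrivial factors; the other stays inside `r` and keeps it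
nontrivial. -/
theorem exists_irreducible_mul_of_decomposable {P : H.Member} (h : Decomposable P) :
    ∃ q r : H.Cls, Irreducible q ∧ r ≠ 1 ∧ H.cls P = q * r := by
  obtain ⟨A, B, hA, hB, hP⟩ := h
  rw [← cls_eq_iff, cls_mul] at hP
  obtain ⟨q, r, hq, hr⟩ := exists_irreducible_mul _ (H.cls A) rfl
    fun h => hA (cls_eq_one_iff.1 h)
  exact ⟨q, r * H.cls B, hq, fun h => hB (cls_eq_one_iff.1 (Cls.mul_eq_one.1 h).2),
    by rw [hP, hr, _root_.mul_assoc]⟩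

/-- A factorization of the class of `P` is realized by the intervals `[⊥, p]` and `[p, ⊤]`. -/
theorem exists_lower_upper {P : H.Member} {a b : H.Cls} (h : H.cls P = a * b) :
    ∃ p : P.1, H.cls (H.lower P p) = a ∧ H.cls (H.upper P p) = b := by
  obtain ⟨A, rfl⟩ := cls_surjective a
  obtain ⟨B, rfl⟩ := cls_surjective b
  obtain ⟨e, he⟩ := exists_equiv_prod h
  obtain ⟨hl, hu⟩ := he (e.symm (⊤, ⊥))
  rw [e.apply_symm_apply, lower_top, cls_lower_eq_one.2 rfl, mul_one] at hl
  rw [e.apply_symm_apply, upper_bot, cls_upper_eq_one.2 rfl, one_mul] at hu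
  exact ⟨_, hl, hu⟩

theorem exists_lower_upper_icc {P : H.Member} {x y : P.1} {hxy : x ≤ y} {a b : H.Cls}
    (h : H.cls (H.icc P x y hxy) = a * b) :
    ∃ (p : P.1) (hx : x ≤ p) (hy : p ≤ y), H.cls (H.icc P x p hx) = a ∧
      H.cls (H.icc P p y hy) = b := by
  obtain ⟨p, hl, hu⟩ := exists_lower_upper h
  rw [lower_icc] at hl
  rw [upper_icc] at hu
  exact ⟨ofIcc p, le_ofIcc p, ofIcc_le p, hl, hu⟩

theorem irreducible_lower_of_isAtom {P : H.Member} {x : P.1} (hx : IsAtom x) :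
    Irreducible (H.cls (H.lower P x)) := by
  rw [Cls.irreducible_iff]
  refine ⟨fun h => hx.1 (cls_lower_eq_one.1 h), fun a b hab => ?_⟩
  obtain ⟨p, hp, hpx, rfl, rfl⟩ := exists_lower_upper_icc hab
  rw [cls_icc_eq_one, cls_icc_eq_one]
  exact (hx.le_iff.1 hpx).imp_left Eq.symm

/-- Under the bijection `[⊥, y] → [⊥, x]`, some `z < y` goes to `⊥` or `x`; the latter would give
`[⊥, z] ∼ [⊥, y]`. -/
theorem isAtom_of_cls_lower_eq {P : H.Member} {x y : P.1} (hx : IsAtom x)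
    (h : H.cls (H.lower P y) = H.cls (H.lower P x)) : IsAtom y := by
  refine ⟨?_, fun z hz => ?_⟩
  · rintro rfl
    rw [cls_lower_eq_one.2 rfl] at h
    exact hx.1 (cls_lower_eq_one.1 h.symm)
  · obtain ⟨e, he⟩ := H.exists_bijection _ _ ((H.cls_eq_iff _ _).1 h)
    have h1 := (H.cls_eq_iff _ _).2 (he (toLower z hz.le)).1
    rw [lower_toLower, lower_lower] at h1
    rcases hx.le_iff.1 (ofLower_le (e (toLower z hz.le))) with h2 | h2
    · rw [h2, cls_lower_eq_one.2 rfl] at h1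
      exact cls_lower_eq_one.1 h1
    · rw [h2] at h1
      exact absurd (eq_of_le_of_cls_lower hz.le (h1.trans h.symm)) hz.ne

/-- The number of elements of `P` with lower interval in the class `c`. -/
noncomputable def lowerCount (P : H.Member) (c : H.Cls) : ℕ :=
  Nat.card {u : P.1 // H.cls (H.lower P u) = c}

theorem lowerCount_congr {P Q : H.Member} (h : H.cls P = H.cls Q) (c : H.Cls) :
    lowerCount P c = lowerCount Q c := by
  obtain ⟨e, he⟩ := H.exists_bijection _ _ ((H.cls_eq_iff _ _).1 h)
  exact Nat.card_congr (e.subtypeEquiv fun u => by rw [(H.cls_eq_iff _ _).2 (he u).1])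

/-- The map `u ↦ (⊥, u)` injects the counted elements of `Q` into those of `P`, and misses `(⊤, ⊥)`,
whose lower interval is also in `c`. -/
theorem lowerCount_lt {P Q : H.Member} {c : H.Cls} (hc : c ≠ 1) (h : H.cls P = c * H.cls Q) :
    lowerCount Q c < lowerCount P c := by
  obtain ⟨C, rfl⟩ := cls_surjective c
  obtain ⟨e, he⟩ := exists_equiv_prod h
  have hl : ∀ u, H.cls (H.lower P (e.symm u)) =
      H.cls (H.lower C u.1) * H.cls (H.lower Q u.2) := fun u => by
    rw [(he _).1, e.apply_symm_apply]
  let f : {u : Q.1 // H.cls (H.lower Q u) = H.cls C} → {u : P.1 // H.cls (H.lower P u) = H.cls C} :=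
    fun u => ⟨e.symm (⊥, u.1), by rw [hl, cls_lower_eq_one.2 rfl, one_mul, u.2]⟩
  have hf : Function.Injective f := fun u v huv =>
    Subtype.ext (Prod.ext_iff.1 (e.symm.injective (congrArg Subtype.val huv))).2
  refine lt_of_le_of_ne (Nat.card_le_card_of_injective f hf) fun heq => ?_
  obtain ⟨u, hu⟩ := ((Nat.bijective_iff_injective_and_card f).2 ⟨hf, heq⟩).2
    ⟨e.symm (⊤, ⊥), by rw [hl, lower_top, cls_lower_eq_one.2 rfl, mul_one]⟩
  have h1 := (Prod.ext_iff.1 (e.symm.injective (congrArg Subtype.val hu))).1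
  refine hc ?_
  rw [← lower_top C]
  exact cls_lower_eq_one.2 h1.symm

theorem exists_not_le_of_lowerCount_lt {P : H.Member} {w y : P.1} {c : H.Cls}
    (h : lowerCount (H.lower P w) c < lowerCount (H.lower P y) c) :
    ∃ u ≤ y, ¬ u ≤ w ∧ H.cls (H.lower P u) = c := by
  by_contra! hno
  have hl : ∀ u : {u : (H.lower P y).1 // H.cls (H.lower (H.lower P y) u) = c},
      H.cls (H.lower P (ofLower u.1)) = c := fun u => by rw [← lower_lower, u.2]
  have hw : ∀ u : {u : (H.lower P y).1 // H.cls (H.lower (H.lower P y) u) = c},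
      ofLower u.1 ≤ w := fun u => by
    by_contra hu
    exact hno _ (ofLower_le u.1) hu (hl u)
  refine h.not_ge (Nat.card_le_card_of_injective
    (fun u => ⟨toLower (ofLower u.1) (hw u), by rw [lower_toLower, hl u]⟩) fun u v huv => ?_)
  exact Subtype.ext (Subtype.ext (congrArg (fun u => u.1.1) huv))

/-- An atom `x` of a decomposable interval `[⊥, y]` with `[x, y]` indecomposable splits it. -/
theorem cls_lower_eq_mul {P : H.Member} {x y : P.1} (hx : IsAtom x) (hxy : x ≤ y)
    (hirr : Irreducible (H.cls (H.icc P x y hxy))) (hdec : Decomposable (H.lower P y)) :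
    H.cls (H.lower P y) = H.cls (H.lower P x) * H.cls (H.icc P x y hxy) := by
  obtain ⟨A, B, hA, hB, h⟩ := hdec
  rw [← cls_eq_iff, cls_mul] at h
  rw [← cls_eq_one_iff] at hA hB
  obtain ⟨e, he⟩ := exists_equiv_prod h
  obtain ⟨hl, hu⟩ := he (toLower x hxy)
  rw [lower_toLower] at hl
  rw [upper_toLower] at hu
  have hxirr := irreducible_lower_of_isAtom hx
  -- `x` lies in a single factor, and the other factor survives whole in `[x, y]`. As `[x, y]` is
  -- irreducible, it equals that other factor, and `x` is the top of its own.
  rcases (Cls.irreducible_iff.1 hxirr).2 _ _ hl with h1 | h1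
  · rw [h1, one_mul] at hl
    rw [cls_lower_eq_one.1 h1, upper_bot] at hu
    have h2 := ((Cls.irreducible_iff.1 hirr).2 _ _ hu).resolve_left hA
    rw [h2, mul_one] at hu
    rw [cls_upper_eq_one.1 h2, lower_top] at hl
    rw [h, hl, hu, _root_.mul_comm]
  · rw [h1, mul_one] at hl
    rw [cls_lower_eq_one.1 h1, upper_bot] at hu
    have h2 := ((Cls.irreducible_iff.1 hirr).2 _ _ hu).resolve_right hB
    rw [h2, one_mul] at hu
    rw [cls_upper_eq_one.1 h2, lower_top] at hl
    rw [h, hl, hu]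

theorem mem_indecSet {P : H.Member} {a : P.1} (h : Irreducible (H.cls (H.lower P a)))
    (ha : a ≠ ⊤) : a ∈ indecSet P :=
  ⟨fun h0 => (irreducible_cls.1 h).1 (cls_lower_eq_one.2 h0), ha, (irreducible_cls.1 h).2⟩

/-! ### Two-element forests and the converse -/

open Classical in
/-- The forest on `{a, b}` whose function `J` takes the value `j` at `{a, b}`. -/
noncomputable def pairForest {P : H.Member} (a b j : P.1) (ha : a ∈ indecSet P)
    (hb : b ∈ indecSet P) (hj : j ≠ ⊤) (haj : a ≤ j) (hbj : b ≤ j) (hab : a = b → j = a)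
    (hover : a ≤ b ∨ b ≤ a ∨ Set.Icc ⊥ a ∩ Set.Icc ⊥ b = {⊥})
    (hlower : H.cls (H.lower P j) =
      ∏ c ∈ ({a, b} : Finset P.1).filter (fun c => Maximal (fun z => z ∈ ({a, b} : Finset P.1)) c),
        H.cls (H.lower P c)) : Forest P where
  F := {a, b}
  F_subset := by
    intro c hc
    rw [Finset.mem_insert, Finset.mem_singleton] at hc
    rcases hc with rfl | rfl <;> assumption
  -- For `a = b` this is a one-element forest; the first branch then gives `j`, which `hab` forces
  -- to be `a`.
  J G := if a ∈ G.1 ∧ b ∈ G.1 then j else if a ∈ G.1 then a else if b ∈ G.1 then b else ⊥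
  J_ne_top G := by
    split_ifs
    · exact hj
    · exact ha.2.1
    · exact hb.2.1
    · exact fun h => ha.2.1 (le_antisymm le_top (h ▸ bot_le))
  nonoverlapping := by
    intro c hc d hd
    rw [Finset.mem_insert, Finset.mem_singleton] at hc hd
    rcases hc with rfl | rfl <;> rcases hd with rfl | rfl
    · exact Or.inl le_rfl
    · exact hover
    · rw [Set.inter_comm]
      tauto
    · exact Or.inl le_rfl
  lower_J := by
    have hsingle : ∀ c : P.1,
        ({c} : Finset P.1).filter (fun z => Maximal (fun u => u ∈ ({c} : Finset P.1)) z) = {c} := by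
      intro c
      ext z
      rw [Finset.mem_filter, Finset.mem_singleton]
      refine ⟨And.left, ?_⟩
      rintro rfl
      exact ⟨rfl, Finset.mem_singleton_self _, fun u hu _ => (Finset.mem_singleton.1 hu).le⟩
    rintro ⟨G, hG⟩
    have hG' : ∀ c ∈ G, c = a ∨ c = b := fun c hc => by
      simpa only [Finset.mem_insert, Finset.mem_singleton] using hG hc
    dsimp only
    split_ifs with h1 h2 h3
    · obtain rfl : G = {a, b} := by
        refine Finset.Subset.antisymm hG fun c hc => ?_
        rw [Finset.mem_insert, Finset.mem_singleton] at hc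
        rcases hc with rfl | rfl
        exacts [h1.1, h1.2]
      exact hlower
    · obtain rfl : G = {a} := by
        ext c
        rw [Finset.mem_singleton]
        refine ⟨fun hc => (hG' c hc).resolve_right ?_, fun hc => hc ▸ h2⟩
        rintro rfl
        exact h1 ⟨h2, hc⟩
      rw [hsingle, Finset.prod_singleton]
    · obtain rfl : G = {b} := by
        ext c
        rw [Finset.mem_singleton]
        refine ⟨fun hc => (hG' c hc).resolve_left ?_, fun hc => hc ▸ h3⟩
        rintro rfl
        exact h2 hc
      rw [hsingle, Finset.prod_singleton]
    · obtain rfl : G = ∅ := by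
        refine Finset.eq_empty_of_forall_notMem fun c hc => ?_
        rcases hG' c hc with rfl | rfl
        exacts [h2 hc, h3 hc]
      rw [Finset.filter_empty, Finset.prod_empty, cls_lower_eq_one]
  J_mono := by
    rintro ⟨G', _⟩ ⟨G, _⟩ hGG
    have h1 := @hGG a
    have h2 := @hGG b
    dsimp only at h1 h2 ⊢
    split_ifs <;> first | exact le_rfl | exact bot_le | assumption | tauto
  J_singleton := by
    intro c hc
    simp only [Finset.mem_insert, Finset.mem_singleton] at hc ⊢
    split_ifs with h1 h2 h3
    · rw [hab (h1.1.trans h1.2.symm), h1.1]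
    · exact h2
    · exact h3
    · rcases hc with rfl | rfl <;> tauto

theorem Forest.mem_predecessors {P : H.Member} {T : Forest P} {a b : P.1} :
    a ∈ (T.predecessors b).1 ↔ a ∈ T.F ∧ a < b ∧ ∀ c ∈ T.F, a < c → ¬ c < b := by
  simp [Forest.predecessors]

/-- In an indecomposable interval `P` with cancellation-free forest expression, `[x, ⊤]` is
indecomposable for each atom `x`. -/
theorem indecomposable_upper_of_isAtom {P : H.Member} (hP : Indecomposable P)
    (hcf : CancellationFree P) {x : P.1} (hx : IsAtom x) : Indecomposable (H.upper P x) := by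
  classical
  intro hdec
  obtain ⟨q, r, hq, hr, hqr⟩ := exists_irreducible_mul_of_decomposable hdec
  -- `y` splits `[x, ⊤]` into `[x, y]` of class `q` and `[y, ⊤]` of class `r`.
  obtain ⟨y, hxy, hyt, hxyq, hyr⟩ := exists_lower_upper_icc hqr
  have hxirr := irreducible_lower_of_isAtom hx
  have hy : y ≠ ⊤ := by
    rintro rfl
    exact hr (hyr ▸ cls_icc_eq_one.2 rfl)
  have hltt : y < ⊤ := lt_of_le_of_ne le_top hy
  have hltxy : x < y := lt_of_le_of_ne hxy fun h =>
    (Cls.irreducible_iff.1 hq).1 (hxyq ▸ cls_icc_eq_one.2 h)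
  have hxt : x < ⊤ := hltxy.trans hltt
  have hxI := mem_indecSet hxirr hxt.ne
  let T : Forest P := pairForest x x x hxI hxI hxt.ne le_rfl le_rfl (fun _ => rfl) (Or.inl le_rfl) <| by
    rw [Finset.pair_eq_singleton, Finset.filter_true_of_mem, Finset.prod_singleton]
    intro z hz
    exact ⟨hz, fun u hu _ => by
      rw [Finset.mem_singleton] at hz hu
      rw [hu, hz]⟩
  have hTF : T.F = {x} := Finset.pair_eq_singleton x
  have hTd : T.d = 2 := by rw [Forest.d, hTF, Finset.card_singleton]
  have hTtop : T.tilde ⊤ = x := by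
    have h1 : x ∈ (T.predecessors ⊤).1 := by
      simp [Forest.mem_predecessors, hTF, hxt]
    exact if_pos ⟨h1, h1⟩
  have hTx : T.tilde x = ⊥ := by
    have h1 : x ∉ (T.predecessors x).1 := by
      simp [Forest.mem_predecessors]
    exact (if_neg fun h => h1 h.1).trans ((if_neg h1).trans (if_neg h1))
  have hT : T.theta = H.cls (H.lower P x) * q * r := by
    rw [T.theta_eq hP, hTF, Finset.prod_singleton, T.factor_eq hTtop le_top,
      T.factor_eq hTx bot_le, _root_.mul_comm, _root_.mul_assoc, ← hqr]
    rfl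
  -- `d` is `2` for the forest `{x}`, so a two-element forest with the same `Θ` has the opposite
  -- sign.
  suffices ∃ T' : Forest P, T'.theta = H.cls (H.lower P x) * q * r ∧ T'.d = 3 by
    obtain ⟨T', hT', hd⟩ := this
    have h := hcf T T' (hT.trans hT'.symm)
    rw [hTd, hd] at h
    norm_num at h
  by_cases hyi : Decomposable (H.lower P y)
  · have hmul := cls_lower_eq_mul hx hxy (hxyq ▸ hq) hyi
    obtain ⟨w, hw0, hwy, hwq, -⟩ := exists_lower_upper_icc (hmul.trans (_root_.mul_comm _ _))
    change H.cls (H.lower P w) = _ at hwq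
    -- An element `v ≤ y` with `[⊥, v] ∼ [⊥, x]` must avoid `[⊥, w]` for the pair to be
    -- non-overlapping. As `∼` does not respect order, `v` is found by counting: `[⊥, y]` contains
    -- more such elements than `[⊥, w]`.
    have hcount : lowerCount (H.lower P w) (H.cls (H.lower P x)) <
        lowerCount (H.lower P y) (H.cls (H.lower P x)) := by
      rw [lowerCount_congr hwq]
      exact lowerCount_lt (Cls.irreducible_iff.1 hxirr).1 hmul
    obtain ⟨v, hvy, hvw, hvx⟩ := exists_not_le_of_lowerCount_lt hcount
    rw [hxyq] at hwq hmul
    have hv := isAtom_of_cls_lower_eq hx hvx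
    have hwt : w ≠ ⊤ := (hwy.trans_lt hltt).ne
    have hwI := mem_indecSet (hwq ▸ hq) hwt
    have hvI := mem_indecSet (hvx ▸ hxirr) (hvy.trans_lt hltt).ne
    have hwv : ¬ w ≤ v := fun h => by
      rcases hv.le_iff.1 h with h | h
      · exact hwI.1 h
      · exact hvw h.ge
    have hne : w ≠ v := fun h => hwv h.le
    let T' : Forest P := pairForest w v y hwI hvI hy hwy hvy (fun h => (hne h).elim)
      (Or.inr (Or.inr (by
        ext z
        simp only [Set.mem_inter_iff, Set.mem_Icc, bot_le, true_and, Set.mem_singleton_iff]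
        constructor
        · rintro ⟨h1, h2⟩
          refine (hv.le_iff.1 h2).resolve_right ?_
          rintro rfl
          exact hvw h1
        · rintro rfl
          exact ⟨bot_le, bot_le⟩))) <| by
      rw [Finset.filter_true_of_mem, Finset.prod_pair hne, hmul, hwq, hvx, _root_.mul_comm]
      intro z hz
      refine ⟨hz, fun u hu hzu => ?_⟩
      rw [Finset.mem_insert, Finset.mem_singleton] at hz hu
      rcases hz with rfl | rfl <;> rcases hu with rfl | rfl
      exacts [le_rfl, (hwv hzu).elim, (hvw hzu).elim, le_rfl]
    have hF : T'.F = {w, v} := rfl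
    have hmem : ∀ a b, a ∈ (T'.predecessors b).1 ↔
        (a = w ∨ a = v) ∧ a < b ∧ ∀ c, c = w ∨ c = v → a < c → ¬ c < b := by
      intro a b
      simp only [Forest.mem_predecessors, hF, Finset.mem_insert, Finset.mem_singleton]
    have hlwv : ¬ w < v := fun h => hwv h.le
    have hlvw : ¬ v < w := fun h => hvw h.le
    have htop : T'.tilde ⊤ = y := by
      refine if_pos ⟨(hmem _ _).2 ?_, (hmem _ _).2 ?_⟩
      · simp [hwy.trans_lt hltt, hlwv]
      · simp [hvy.trans_lt hltt, hlvw]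
    have htw : T'.tilde w = ⊥ := by
      have h1 : w ∉ (T'.predecessors w).1 := by simp [hmem]
      have h2 : v ∉ (T'.predecessors w).1 := by simp [hmem, hlvw]
      exact (if_neg fun h => h1 h.1).trans ((if_neg h1).trans (if_neg h2))
    have htv : T'.tilde v = ⊥ := by
      have h1 : w ∉ (T'.predecessors v).1 := by simp [hmem, hlwv]
      have h2 : v ∉ (T'.predecessors v).1 := by simp [hmem]
      exact (if_neg fun h => h1 h.1).trans ((if_neg h1).trans (if_neg h2))
    refine ⟨T', ?_, by rw [Forest.d, hF, Finset.card_pair hne]⟩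
    rw [T'.theta_eq hP, hF, Finset.prod_pair hne, T'.factor_eq htop le_top,
      T'.factor_eq htw bot_le, T'.factor_eq htv bot_le, hyr]
    change r * (H.cls (H.lower P w) * H.cls (H.lower P v)) = _
    rw [hwq, hvx, _root_.mul_comm, _root_.mul_comm q]
  -- Here `[⊥, y]` is indecomposable, and the chain `x < y` has the factors `[⊥, x]`, `[x, y]`, `[y,
  -- ⊤]`.
  · have hy0 : y ≠ ⊥ := (bot_le.trans_lt hltxy).ne'
    let T' : Forest P := pairForest x y y hxI ⟨hy0, hy, hyi⟩ hy hxy le_rfl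
      (fun h => h.symm) (Or.inl hxy) <| by
      have : ({x, y} : Finset P.1).filter
          (fun c => Maximal (fun z => z ∈ ({x, y} : Finset P.1)) c) = {y} := by
        ext z
        simp only [Finset.mem_filter, Finset.mem_insert, Finset.mem_singleton]
        constructor
        · rintro ⟨rfl | rfl, h⟩
          · exact (h.eq_of_le (Or.inr rfl) hxy)
          · rfl
        · rintro rfl
          refine ⟨Or.inr rfl, Or.inr rfl, ?_⟩
          rintro u (rfl | rfl) _
          exacts [hxy, le_rfl]
      rw [this, Finset.prod_singleton]
    have hF : T'.F = {x, y} := rfl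
    have hmem : ∀ a b, a ∈ (T'.predecessors b).1 ↔
        (a = x ∨ a = y) ∧ a < b ∧ ∀ c, c = x ∨ c = y → a < c → ¬ c < b := by
      intro a b
      simp only [Forest.mem_predecessors, hF, Finset.mem_insert, Finset.mem_singleton]
    have htop : T'.tilde ⊤ = y := by
      have h1 : x ∉ (T'.predecessors ⊤).1 := by
        simp only [hmem, not_and, not_forall, not_not]
        exact fun _ _ => ⟨y, Or.inr rfl, hltxy, hltt⟩
      have h2 : y ∈ (T'.predecessors ⊤).1 := by
        simp [hmem, hltxy.not_gt, hltt]
      exact (if_neg fun h => h1 h.1).trans ((if_neg h1).trans (if_pos h2))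
    have hty : T'.tilde y = x := by
      have h1 : x ∈ (T'.predecessors y).1 := by
        simp [hmem, hltxy]
      have h2 : y ∉ (T'.predecessors y).1 := by
        simp [hmem]
      exact (if_neg fun h => h2 h.2).trans (if_pos h1)
    have htx : T'.tilde x = ⊥ := by
      have h1 : x ∉ (T'.predecessors x).1 := by simp [hmem]
      have h2 : y ∉ (T'.predecessors x).1 := by simp [hmem, hltxy.not_gt]
      exact (if_neg fun h => h1 h.1).trans ((if_neg h1).trans (if_neg h2))
    refine ⟨T', ?_, by rw [Forest.d, hF, Finset.card_pair hltxy.ne]⟩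
    rw [T'.theta_eq hP, hF, Finset.prod_pair hltxy.ne, T'.factor_eq htop le_top,
      T'.factor_eq htx bot_le, T'.factor_eq hty hxy, hyr, hxyq, _root_.mul_comm]
    rfl

/-- For an atom `t ≤ x`, `[t, ⊤]` is indecomposable and smaller than `P`, and `[x, ⊤]` is one of its
upper intervals, so induction on size applies. -/
theorem upperIndecomposable_of_cancellationFree
    (h : ∀ P : H.Member, Indecomposable P → CancellationFree P) : H.UpperIndecomposable := by
  intro P
  induction hn : (H.cls P).card using Nat.strong_induction_on generalizing P with
  | _ n ih =>
    intro hP x hx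
    rcases eq_bot_or_exists_atom_le x with rfl | ⟨t, ht, htx⟩
    · rwa [upper_bot]
    · have h1 := ih _ (hn ▸ card_upper_lt ht.1) (H.upper P t) rfl
        (indecomposable_upper_of_isAtom hP (h P hP) ht) (toUpper x htx)
        (lt_of_le_of_ne le_top fun h => hx.ne (congrArg (ofIcc (h := le_top)) h))
      rwa [upper_toUpper] at h1

end HereditaryFamily

theorem mainTheorem5 {U : Type*} (H : HereditaryFamily U) :
    (∀ P : H.Member, HereditaryFamily.Indecomposable P → HereditaryFamily.CancellationFree P) ↔
      H.UpperIndecomposable :=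
  ⟨HereditaryFamily.upperIndecomposable_of_cancellationFree,
    fun hH _ hP => HereditaryFamily.cancellationFree_of_upperIndecomposable hH hP⟩
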